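/- Let $(X,d)$ be a complete metric space that is * Busemann concave: $X$ is geodesic, and for all constant speed geodesics $\gamma,\eta:[0,1]\to X$ with $\gamma(0)=\eta(0)$ the function $t\mapsto d(\gamma(t),\eta(t))$ is concave on $[0,1]$; and * locally doubling: for every $z\in X$ there are $R>0$ and $N\in\mathbb{N}$ such that for all $y\in B_R(z)$ and $0<r\le R$ the ball $B_r(y)$ can be covered by at most $N$ balls of radius $r/2$. Fix $x\in X$. Let $\Gamma_x$ be the set of maximal unit speed geodesics starting at $x$, i.e. maps $\gamma:I\to X$ on an interval $I\subset[0,\infty)$ containing $0$ with $\gamma(0)=x$ and $d(\gamma(s),\gamma(t))=|s-t|$ for $s,t\in I$ that have no proper extension of the same kind. The pre-tangent cone $\hat T_xX$ is $\Gamma_x\times[0,\infty)$ with all points $(\gamma,0)$ identified to one point $o$, with the distance $$d_x((\gamma,s),(\eta,t))=\sup\Big\{\tfrac1r\,d(\gamma(rs),\eta(rt)) : r\in(0,1],\ \gamma(rs)\text{ and }\eta(rt)\text{ are defined}\Big\},$$ and the tangent cone $(T_xX,d_x)$ is the metric completion of $(\hat T_xX,d_x)$ (if $X=\{x\}$, it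 is a single point). Say that pointed metric spaces $(X_i,d_i,x_i)$ converge to $(Y,d_Y,y)$ in the pointed Gromov–Hausdorff sense if for every $r>0$ the Gromov–Hausdorff distance of the pointed balls $(B_r(x_i),x_i)$ and $(B_r(y),y)$ tends to $0$; here the Gromov–Hausdorff distance of two pointed metric spaces is the infimum of the Hausdorff distances of their images over all pairs of isometric embeddings into a common metric space that send the two base points to the same point. Then: 1. $(T_xX,d_x)$ is locally compact. 2. $(X,\frac1\lambda d,x)$ converges to $(T_xX,d_x,o)$ in the pointed Gromov–Hausdorff sense as $\lambda\to0^+$. 3. The limit is unique: if $\lambda_n>0$, $\lambda_n\to0$ and $(X,\frac1{\lambda_n}d,x)$ converges in the pointed Gromov–Hausdorff sense to a complete pointed metric space $(Y,d_Y,y)$, then there is a surjective isometry $T_xX\to Y$ that maps $o$ to $y$. -/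

import Mathlib

open Set Filter Topology
open scoped NNReal ENNReal

universe u v

namespace BusemannTangent

/-! ### Busemann concave spaces and local doubling -/

/-- `γ`, restricted to `[0,1]`, is a constant speed geodesic from `x` to `y`. -/
structure IsGeodesic {X : Type u} [MetricSpace X] (γ : ℝ → X) (x y : X) : Prop where
  source : γ 0 = x
  target : γ 1 = y
  dist_eq : ∀ s ∈ Icc (0 : ℝ) 1, ∀ t ∈ Icc (0 : ℝ) 1, dist (γ s) (γ t) = |s - t| * dist x y

/-- A geodesic metric space such that `t ↦ d(γ t, η t)` is concave on `[0,1]` for any two constant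
speed geodesics `γ`, `η` with the same initial point. -/
class IsBusemannConcave (X : Type u) [MetricSpace X] : Prop where
  exists_geodesic : ∀ x y : X, ∃ γ : ℝ → X, IsGeodesic γ x y
  concaveOn : ∀ (x y₁ y₂ : X) (γ η : ℝ → X), IsGeodesic γ x y₁ → IsGeodesic η x y₂ →
    ConcaveOn ℝ (Icc (0 : ℝ) 1) fun t => dist (γ t) (η t)

/-- Every point `x` has a radius `R` and a number `N` such that each ball with center in `B_R(x)`
and radius `r ≤ R` is covered by at most `N` balls of radius `r / 2`. -/
def IsLocallyDoubling (X : Type u) [MetricSpace X] : Prop :=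
  ∀ x : X, ∃ R : ℝ, 0 < R ∧ ∃ N : ℕ, ∀ y ∈ Metric.ball x R, ∀ r : ℝ, 0 < r → r ≤ R →
    ∃ s : Finset X, s.card ≤ N ∧ Metric.ball y r ⊆ ⋃ z ∈ s, Metric.ball z (r / 2)

/-! ### Unit speed geodesics from a point -/

/-- A unit speed geodesic starting at `x`, defined on an interval `dom` of one of the forms `[0,a]`,
`[0,a)`, `[0,∞)`. Outside `dom` the function is set to the value `x`, so that two geodesics are
equal iff their domains agree and they agree on it. -/
@[ext]
structure UnitSpeedGeodesic {X : Type u} [MetricSpace X] (x : X) where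
  dom : Set ℝ
  toFun : ℝ → X
  ordConnected : dom.OrdConnected
  zero_mem : (0 : ℝ) ∈ dom
  nonneg : ∀ t ∈ dom, 0 ≤ t
  map_zero : toFun 0 = x
  dist_eq : ∀ s ∈ dom, ∀ t ∈ dom, dist (toFun s) (toFun t) = |s - t|
  outside : ∀ t, t ∉ dom → toFun t = x

namespace UnitSpeedGeodesic

variable {X : Type u} [MetricSpace X] {x : X}

/-- `η` extends `γ`. -/
def Extends (η γ : UnitSpeedGeodesic x) : Prop :=
  γ.dom ⊆ η.dom ∧ EqOn η.toFun γ.toFun γ.dom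

/-- `γ` has no proper extension to a unit speed geodesic starting at `x`. -/
def IsMaximal (γ : UnitSpeedGeodesic x) : Prop :=
  ∀ η : UnitSpeedGeodesic x, η.Extends γ → η = γ

theorem mem_of_le (γ : UnitSpeedGeodesic x) {s t : ℝ} (ht : t ∈ γ.dom) (hs : 0 ≤ s)
    (hst : s ≤ t) : s ∈ γ.dom :=
  γ.ordConnected.out γ.zero_mem ht ⟨hs, hst⟩

theorem dist_base (γ : UnitSpeedGeodesic x) {s : ℝ} (hs : s ∈ γ.dom) :
    dist x (γ.toFun s) = s := by
  have h := γ.dist_eq 0 γ.zero_mem s hs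
  rwa [γ.map_zero, zero_sub, abs_neg, abs_of_nonneg (γ.nonneg s hs)] at h

theorem Extends.antisymm {γ η : UnitSpeedGeodesic x} (h : η.Extends γ) (h' : γ.Extends η) :
    η = γ := by
  have hd : η.dom = γ.dom := Subset.antisymm h'.1 h.1
  refine UnitSpeedGeodesic.ext hd (funext fun t => ?_)
  by_cases ht : t ∈ γ.dom
  · exact h.2 ht
  · rw [γ.outside t ht, η.outside t (by rwa [hd])]

variable (x) in
theorem exists_isMaximal : ∃ γ : UnitSpeedGeodesic x, γ.IsMaximal := by
  classical
  have key : ∃ m : UnitSpeedGeodesic x, ∀ a, a.Extends m → m.Extends a := by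
    refine exists_maximal_of_chains_bounded (r := fun γ η => Extends η γ) ?_ ?_
    · intro c hc
      have hcomp : ∀ γ ∈ c, ∀ η ∈ c, γ.Extends η ∨ η.Extends γ := by
        intro γ hγ η hη
        by_cases h : γ = η
        · subst h; exact Or.inl ⟨Subset.rfl, fun _ _ => rfl⟩
        · exact (hc hγ hη h).symm
      have hagree : ∀ γ ∈ c, ∀ η ∈ c, ∀ t, t ∈ γ.dom → t ∈ η.dom → γ.toFun t = η.toFun t := by
        intro γ hγ η hη t h1 h2
        rcases hcomp γ hγ η hη with h | h
        · exact h.2 h2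
        · exact (h.2 h1).symm
      let f : ℝ → X := fun t => if h : ∃ γ ∈ c, t ∈ γ.dom then h.choose.toFun t else x
      have hf : ∀ γ ∈ c, ∀ t ∈ γ.dom, f t = γ.toFun t := by
        intro γ hγ t ht
        have h : ∃ γ ∈ c, t ∈ γ.dom := ⟨γ, hγ, ht⟩
        simp only [f, dif_pos h]
        exact hagree _ h.choose_spec.1 _ hγ t h.choose_spec.2 ht
      have hboth : ∀ γ ∈ c, ∀ η ∈ c, ∀ s ∈ γ.dom, ∀ t ∈ η.dom,
          ∃ ζ ∈ c, s ∈ ζ.dom ∧ t ∈ ζ.dom := by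
        intro γ hγ η hη s hs t ht
        rcases hcomp γ hγ η hη with h | h
        · exact ⟨γ, hγ, hs, h.1 ht⟩
        · exact ⟨η, hη, h.1 hs, ht⟩
      refine ⟨⟨{t | t = 0 ∨ ∃ γ ∈ c, t ∈ γ.dom}, f, ⟨?_⟩, Or.inl rfl, ?_, ?_, ?_, ?_⟩,
        fun γ hγ => ⟨fun t ht => Or.inr ⟨γ, hγ, ht⟩, fun t ht => hf γ hγ t ht⟩⟩
      · rintro s hs t (rfl | ⟨γ, hγ, ht⟩) r hr
        · have hs0 : 0 ≤ s := by
            rcases hs with rfl | ⟨η, _, h⟩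
            · exact le_rfl
            · exact η.nonneg s h
          exact Or.inl (le_antisymm hr.2 (hs0.trans hr.1))
        · have hs0 : 0 ≤ s := by
            rcases hs with rfl | ⟨η, _, h⟩
            · exact le_rfl
            · exact η.nonneg s h
          exact Or.inr ⟨γ, hγ, γ.mem_of_le ht (hs0.trans hr.1) hr.2⟩
      · rintro t (rfl | ⟨γ, _, h⟩)
        · exact le_rfl
        · exact γ.nonneg t h
      · by_cases h : ∃ γ ∈ c, (0 : ℝ) ∈ γ.dom
        · obtain ⟨γ, hγ, h0⟩ := h
          rw [hf γ hγ 0 h0, γ.map_zero]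
        · simp only [f, dif_neg h]
      · by_cases hne : c.Nonempty
        · obtain ⟨ζ, hζ⟩ := hne
          have hmem : ∀ t, (t = 0 ∨ ∃ γ ∈ c, t ∈ γ.dom) → ∃ γ ∈ c, t ∈ γ.dom := by
            rintro t (rfl | h)
            · exact ⟨ζ, hζ, ζ.zero_mem⟩
            · exact h
          intro s hs t ht
          obtain ⟨γ, hγ, hs'⟩ := hmem s hs
          obtain ⟨η, hη, ht'⟩ := hmem t ht
          obtain ⟨ξ, hξ, h1, h2⟩ := hboth γ hγ η hη s hs' t ht'
          rw [hf ξ hξ s h1, hf ξ hξ t h2, ξ.dist_eq s h1 t h2]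
        · have hmem : ∀ t, (t = 0 ∨ ∃ γ ∈ c, t ∈ γ.dom) → t = 0 := by
            rintro t (rfl | ⟨γ, hγ, _⟩)
            · rfl
            · exact absurd ⟨γ, hγ⟩ hne
          intro s hs t ht
          rw [hmem s hs, hmem t ht]; simp
      · intro t ht
        have h : ¬ ∃ γ ∈ c, t ∈ γ.dom := fun h => ht (Or.inr h)
        simp only [f, dif_neg h]
    · intro a b c hab hbc
      exact ⟨hab.1.trans hbc.1, fun t ht => (hbc.2 (hab.1 ht)).trans (hab.2 ht)⟩
  obtain ⟨m, hm⟩ := key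
  exact ⟨m, fun η h => h.antisymm (hm η h)⟩

/-- In a geodesic space with more than one point, maximal geodesics have positive length. -/
theorem IsMaximal.exists_pos [IsBusemannConcave X] {γ : UnitSpeedGeodesic x}
    (hγ : γ.IsMaximal) {y : X} (hy : y ≠ x) : ∃ a ∈ γ.dom, 0 < a := by
  classical
  by_contra hcon
  push Not at hcon
  obtain ⟨c, hc⟩ := IsBusemannConcave.exists_geodesic x y
  have hl : 0 < dist x y := dist_pos.2 hy.symm
  set l := dist x y with hldef
  have hdiv : ∀ t ∈ Icc (0 : ℝ) l, t / l ∈ Icc (0 : ℝ) 1 := fun t ht =>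
    ⟨div_nonneg ht.1 hl.le, (div_le_one hl).2 ht.2⟩
  let η : UnitSpeedGeodesic x :=
    { dom := Icc 0 l
      toFun := fun t => if t ∈ Icc (0 : ℝ) l then c (t / l) else x
      ordConnected := ordConnected_Icc
      zero_mem := ⟨le_rfl, hl.le⟩
      nonneg := fun t ht => ht.1
      map_zero := by simp [hl.le, hc.source]
      dist_eq := by
        intro s hs t ht
        rw [if_pos hs, if_pos ht, hc.dist_eq _ (hdiv s hs) _ (hdiv t ht), ← sub_div, abs_div,
          abs_of_pos hl, ← hldef, div_mul_cancel₀ _ hl.ne']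
      outside := fun t ht => if_neg ht }
  have h0 : ∀ t ∈ γ.dom, t = 0 := fun t ht => le_antisymm (hcon t ht) (γ.nonneg t ht)
  have hext : η.Extends γ := by
    refine ⟨fun t ht => ?_, fun t ht => ?_⟩
    · rw [h0 t ht]; exact η.zero_mem
    · rw [h0 t ht, η.map_zero, γ.map_zero]
  have hmem : l ∈ η.dom := ⟨hl.le, le_rfl⟩
  rw [hγ η hext] at hmem
  exact absurd (hcon l hmem) (not_le.2 hl)

end UnitSpeedGeodesic

/-! ### The tangent cone -/

/-- The set `Γ_x` of maximal unit speed geodesics starting at `x`. -/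
def MaximalGeodesic {X : Type u} [MetricSpace X] (x : X) : Type u :=
  {γ : UnitSpeedGeodesic x // γ.IsMaximal}

instance {X : Type u} [MetricSpace X] (x : X) : Nonempty (MaximalGeodesic x) :=
  let ⟨γ, h⟩ := UnitSpeedGeodesic.exists_isMaximal x
  ⟨⟨γ, h⟩⟩

section Cone

variable {X : Type u} [MetricSpace X] {x : X}

/-- The numbers `d(γ(rs), η(rt)) / r`, for `r ∈ (0,1]` such that `γ(rs)` and `η(rt)` are defined. -/
def scaledDists (p q : MaximalGeodesic x × ℝ≥0) : Set ℝ :=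
  {ρ | ∃ r : ℝ, 0 < r ∧ r ≤ 1 ∧ r * p.2 ∈ p.1.1.dom ∧ r * q.2 ∈ q.1.1.dom ∧
    ρ = dist (p.1.1.toFun (r * p.2)) (q.1.1.toFun (r * q.2)) / r}

/-- `d_x((γ,s),(η,t)) = sup_r d(γ(rs), η(rt)) / r`. In a Busemann concave space the quotient is
non-increasing in `r`, so the supremum is the limit for `r → 0`, and does not change if `r` is
restricted further by an upper bound. (If `X` is the single point `x`, the set may be empty; its
supremum is then read as `0`, and the cone is a point.) -/
noncomputable def coneDist (p q : MaximalGeodesic x × ℝ≥0) : ℝ :=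
  sSup (scaledDists p q)

theorem scaledDists_le {p q : MaximalGeodesic x × ℝ≥0} {ρ : ℝ} (h : ρ ∈ scaledDists p q) :
    ρ ≤ p.2 + q.2 := by
  obtain ⟨r, hr, -, hp, hq, rfl⟩ := h
  rw [div_le_iff₀ hr]
  have := dist_triangle_left (p.1.1.toFun (r * p.2)) (q.1.1.toFun (r * q.2)) x
  rw [p.1.1.dist_base hp, q.1.1.dist_base hq] at this
  linarith

theorem bddAbove_scaledDists (p q : MaximalGeodesic x × ℝ≥0) : BddAbove (scaledDists p q) :=
  ⟨p.2 + q.2, fun _ h => scaledDists_le h⟩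

theorem coneDist_nonneg (p q : MaximalGeodesic x × ℝ≥0) : 0 ≤ coneDist p q := by
  refine Real.sSup_nonneg ?_
  rintro _ ⟨r, hr, -, -, -, rfl⟩
  exact div_nonneg dist_nonneg hr.le

theorem coneDist_self (p : MaximalGeodesic x × ℝ≥0) : coneDist p p = 0 := by
  refine le_antisymm (Real.sSup_le ?_ le_rfl) (coneDist_nonneg p p)
  rintro _ ⟨r, -, -, -, -, rfl⟩
  simp

theorem coneDist_comm (p q : MaximalGeodesic x × ℝ≥0) : coneDist p q = coneDist q p := by
  have : ∀ p q : MaximalGeodesic x × ℝ≥0, scaledDists p q ⊆ scaledDists q p := by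
    rintro p q _ ⟨r, h0, h1, hp, hq, rfl⟩
    exact ⟨r, h0, h1, hq, hp, by rw [dist_comm]⟩
  exact congrArg sSup (Subset.antisymm (this p q) (this q p))

theorem isGeodesic_rescale (γ : UnitSpeedGeodesic x) {a : ℝ} (ha : a ∈ γ.dom) :
    IsGeodesic (fun t => γ.toFun (t * a)) x (γ.toFun a) := by
  have h0 := γ.nonneg a ha
  have hmem : ∀ t ∈ Icc (0 : ℝ) 1, t * a ∈ γ.dom := fun t ht =>
    γ.mem_of_le ha (mul_nonneg ht.1 h0) (mul_le_of_le_one_left h0 ht.2)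
  refine ⟨by simp [γ.map_zero], by simp, fun s hs t ht => ?_⟩
  rw [γ.dist_eq _ (hmem s hs) _ (hmem t ht), γ.dist_base ha, ← sub_mul, abs_mul, abs_of_nonneg h0]

/-- The quotient `d(γ(rs), η(rt)) / r` is non-increasing in `r`. -/
theorem scaledDist_antitone [IsBusemannConcave X] (γ η : UnitSpeedGeodesic x) {s t r u : ℝ}
    (hr : 0 < r) (hs : r * s ∈ γ.dom) (ht : r * t ∈ η.dom) (hu : 0 < u) (hu1 : u ≤ 1) :
    dist (γ.toFun (r * s)) (η.toFun (r * t)) / r ≤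
      dist (γ.toFun (u * r * s)) (η.toFun (u * r * t)) / (u * r) := by
  have hc := IsBusemannConcave.concaveOn x _ _ _ _ (isGeodesic_rescale γ hs)
    (isGeodesic_rescale η ht)
  have h := hc.2 (x := 1) (y := 0) (by simp) (by simp) hu.le (sub_nonneg.2 hu1) (by ring)
  simp only [smul_eq_mul, mul_one, mul_zero, add_zero, one_mul, zero_mul, γ.map_zero, η.map_zero,
    dist_self] at h
  rw [div_le_div_iff₀ hr (mul_pos hu hr), mul_assoc u r s, mul_assoc u r t]
  nlinarith

theorem coneDist_triangle [IsBusemannConcave X] (p q w : MaximalGeodesic x × ℝ≥0) :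
    coneDist p w ≤ coneDist p q + coneDist q w := by
  refine Real.sSup_le ?_ (add_nonneg (coneDist_nonneg p q) (coneDist_nonneg q w))
  rintro _ ⟨r, hr, hr1, hp, hw, rfl⟩
  by_cases hX : ∃ y : X, y ≠ x
  · obtain ⟨y, hy⟩ := hX
    obtain ⟨a, ha, ha0⟩ := q.1.2.exists_pos hy
    have hq0 : (0 : ℝ) ≤ q.2 := q.2.2
    have hden : 0 < r * (q.2 : ℝ) + a := by positivity
    obtain ⟨u, hu, hu1, hua⟩ : ∃ u : ℝ, 0 < u ∧ u ≤ 1 ∧ u * r * q.2 ≤ a := by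
      refine ⟨a / (r * q.2 + a), by positivity, ?_, ?_⟩
      · rw [div_le_one hden]
        nlinarith [mul_nonneg hr.le hq0]
      · rw [mul_assoc, div_mul_eq_mul_div, div_le_iff₀ hden]
        nlinarith
    have hur : 0 < u * r := mul_pos hu hr
    have hur1 : u * r ≤ 1 := mul_le_one₀ hu1 hr.le hr1
    have hqm : u * r * q.2 ∈ q.1.1.dom := q.1.1.mem_of_le ha (by positivity) hua
    have hsmall : ∀ z : MaximalGeodesic x × ℝ≥0, r * z.2 ∈ z.1.1.dom →
        u * r * z.2 ∈ z.1.1.dom := fun z hz => by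
      rw [mul_assoc]
      exact z.1.1.mem_of_le hz (by positivity) (mul_le_of_le_one_left (by positivity) hu1)
    refine (scaledDist_antitone p.1.1 w.1.1 hr hp hw hu hu1).trans ?_
    have h1 : dist (p.1.1.toFun (u * r * p.2)) (q.1.1.toFun (u * r * q.2)) / (u * r) ≤
        coneDist p q :=
      le_csSup (bddAbove_scaledDists p q) ⟨u * r, hur, hur1, hsmall p hp, hqm, rfl⟩
    have h2 : dist (q.1.1.toFun (u * r * q.2)) (w.1.1.toFun (u * r * w.2)) / (u * r) ≤
        coneDist q w :=
      le_csSup (bddAbove_scaledDists q w) ⟨u * r, hur, hur1, hqm, hsmall w hw, rfl⟩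
    refine le_trans ?_ (add_le_add h1 h2)
    rw [← add_div]
    exact div_le_div_of_nonneg_right (dist_triangle _ _ _) hur.le
  · push Not at hX
    rw [hX (p.1.1.toFun _), hX (w.1.1.toFun _), dist_self, zero_div]
    exact add_nonneg (coneDist_nonneg p q) (coneDist_nonneg q w)

theorem coneDist_tip (p q : MaximalGeodesic x × ℝ≥0) (hp : p.2 = 0) (hq : q.2 = 0) :
    coneDist p q = 0 := by
  refine le_antisymm (Real.sSup_le ?_ le_rfl) (coneDist_nonneg p q)
  intro ρ hρ
  simpa [hp, hq] using scaledDists_le hρ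

variable (x) in
/-- The identification of all points `(γ, 0)`. -/
def tipSetoid : Setoid (MaximalGeodesic x × ℝ≥0) where
  r p q := p = q ∨ (p.2 = 0 ∧ q.2 = 0)
  iseqv :=
    { refl := fun _ => Or.inl rfl
      symm := by
        rintro p q (rfl | ⟨h, h'⟩)
        · exact Or.inl rfl
        · exact Or.inr ⟨h', h⟩
      trans := by
        rintro p q w (rfl | ⟨h, h'⟩) (rfl | ⟨k, k'⟩)
        · exact Or.inl rfl
        · exact Or.inr ⟨k, k'⟩
        · exact Or.inr ⟨h, h'⟩
        · exact Or.inr ⟨h, k'⟩ }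

variable (x) in
/-- The pre-tangent cone at `x`: the set `Γ_x × [0,∞)` with all points `(γ, 0)` identified. -/
def PreTangentCone : Type u := Quotient (tipSetoid x)

theorem coneDist_congr [IsBusemannConcave X] {p p' q q' : MaximalGeodesic x × ℝ≥0}
    (hp : tipSetoid x p p') (hq : tipSetoid x q q') : coneDist p q = coneDist p' q' := by
  have zero : ∀ {a b : MaximalGeodesic x × ℝ≥0}, tipSetoid x a b → coneDist a b = 0 := by
    rintro a b (rfl | ⟨h, h'⟩)
    · exact coneDist_self a
    · exact coneDist_tip a b h h'
  have hp0 := zero hp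
  have hq0 := zero hq
  have h1 := coneDist_triangle p p' q
  have h2 := coneDist_triangle p' q' q
  have h3 := coneDist_triangle p' p q'
  have h4 := coneDist_triangle p q q'
  rw [coneDist_comm q' q] at h2
  rw [coneDist_comm p' p] at h3
  linarith

/-- The distance `d_x` on the pre-tangent cone. -/
noncomputable instance [IsBusemannConcave X] : PseudoMetricSpace (PreTangentCone x) where
  dist := Quotient.lift₂ coneDist fun _ _ _ _ hp hq => coneDist_congr hp hq
  dist_self := by rintro ⟨p⟩; exact coneDist_self p
  dist_comm := by rintro ⟨p⟩ ⟨q⟩; exact coneDist_comm p q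
  dist_triangle := by rintro ⟨p⟩ ⟨q⟩ ⟨w⟩; exact coneDist_triangle p q w

variable (x) in
/-- The tangent cone `(T_x X, d_x)`: the metric completion of the pre-tangent cone. -/
abbrev TangentCone [IsBusemannConcave X] : Type u :=
  UniformSpace.Completion (PreTangentCone x)

variable (x) in
/-- The class of the points `(γ, 0)` in the pre-tangent cone. -/
noncomputable def PreTangentCone.tip : PreTangentCone x :=
  Quotient.mk (tipSetoid x) (Classical.arbitrary (MaximalGeodesic x), 0)

variable (x) in
/-- The base point of the tangent cone. -/
noncomputable def TangentCone.tip [IsBusemannConcave X] : TangentCone x :=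
  ((PreTangentCone.tip x : PreTangentCone x) : UniformSpace.Completion (PreTangentCone x))

end Cone

/-! ### Pointed Gromov–Hausdorff convergence and blow-ups -/

/-- A metric coupling of two pointed metric spaces: isometric embeddings into a common metric
space that send both base points to the same point. -/
structure PointedCoupling {X : Type u} {Y : Type v} [MetricSpace X] [MetricSpace Y]
    (x : X) (y : Y) where
  Z : Type (max u v)
  [metric : MetricSpace Z]
  left : X → Z
  right : Y → Z
  isometry_left : Isometry left
  isometry_right : Isometry right
  base_eq : left x = right y

attribute [instance] PointedCoupling.metric

/-- The Gromov–Hausdorff distance of `(X,x)` and `(Y,y)`: the infimum, over all metric couplings of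
the pointed spaces, of the Hausdorff distance of the images. -/
noncomputable def pointedGHDist {X : Type u} {Y : Type v} [MetricSpace X] [MetricSpace Y]
    (x : X) (y : Y) : ℝ≥0∞ :=
  ⨅ c : PointedCoupling x y, Metric.hausdorffEDist (range c.left) (range c.right)

/-- Pointed Gromov–Hausdorff convergence of `(X i, x i)` to `(Y, y)` along the filter `l`: for each
`r > 0` the Gromov–Hausdorff distance of the pointed balls of radius `r` tends to `0`. -/
def PointedGHTendsto {ι : Type*} (X : ι → Type u) [∀ i, MetricSpace (X i)] (x : ∀ i, X i)
    (l : Filter ι) (Y : Type v) [MetricSpace Y] (y : Y) : Prop :=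
  ∀ (r : ℝ) (hr : 0 < r), Tendsto
    (fun i => pointedGHDist
      (⟨x i, Metric.mem_ball_self hr⟩ : Metric.ball (x i) r)
      (⟨y, Metric.mem_ball_self hr⟩ : Metric.ball y r)) l (𝓝 0)

/-- A copy of the set `X`, to be equipped with the metric `d / lam`. -/
@[ext]
structure Blowup (X : Type u) (lam : Ioi (0 : ℝ)) : Type u where
  val : X

/-- The rescaled metric `d / lam`. -/
noncomputable instance (X : Type u) [MetricSpace X] (lam : Ioi (0 : ℝ)) :
    MetricSpace (Blowup X lam) where
  dist p q := dist p.val q.val / (lam : ℝ)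
  dist_self p := by simp
  dist_comm p q := by simp only [dist_comm]
  dist_triangle p q w := by
    rw [← add_div]
    exact div_le_div_of_nonneg_right (dist_triangle _ _ _) (le_of_lt lam.2)
  eq_of_dist_eq_zero {p q} h := by
    rcases div_eq_zero_iff.1 h with h0 | h0
    · exact Blowup.ext (dist_eq_zero.1 h0)
    · exact absurd h0 (ne_of_gt lam.2)

end BusemannTangent

/-!
By Busemann concavity the rescaled distances `d (γ (r s)) (η (r t)) / r` increase as `r` decreases,
so the supremum defining `d_x` is a limit as `r → 0`. The exponential maps `(γ, s) ↦ γ (lam s)` from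
the cone to the blow-ups are therefore almost isometric on every finite set once `lam` is small.
They are also 1-Lipschitz for `lam ≤ 1` and surjective, and they preserve the distance to the base
point. Doubling bounds the number of separated points in a ball of the blow-ups, uniformly in the
scale, and this bound passes to the cone. Hence balls of the cone are totally bounded, and the image
of a finite net of such a ball is a net of the ball of the blow-up, which yields the
Gromov–Hausdorff convergence.

For the uniqueness, two pointed spaces whose balls are arbitrarily close are compared through
correspondences of smaller and smaller distortion; in a proper space these have a limit, which is
the graph of an isometry.
-/

namespace BusemannTangent

/-! ### Gluing pointed metric spaces along a correspondence -/

section Bridge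

variable {A : Type*} {B : Type*} [PseudoMetricSpace A] [PseudoMetricSpace B] {ι : Type*}

/-- The length of the shortest way from `p : A` to `q : B` when bridges of length `e i` join the
points `Φ i` of `A` to the points `Ψ i` of `B`. Unlike in Mathlib's `Metric.glueDist`, the length
depends on the bridge, so that one of them can be contracted to a point. -/
noncomputable def bridgeDist (Φ : ι → A) (Ψ : ι → B) (e : ι → ℝ) (p : A) (q : B) : ℝ :=
  ⨅ i, (dist p (Φ i) + e i + dist (Ψ i) q)

variable {Φ : ι → A} {Ψ : ι → B} {e : ι → ℝ}

theorem bridgeDist_comm (p : A) (q : B) : bridgeDist Φ Ψ e p q = bridgeDist Ψ Φ e q p :=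
  iInf_congr fun i => by rw [dist_comm p, dist_comm _ q]; ring

theorem bridgeDist_le (he : ∀ i, 0 ≤ e i) (p : A) (q : B) (i : ι) :
    bridgeDist Φ Ψ e p q ≤ dist p (Φ i) + e i + dist (Ψ i) q :=
  ciInf_le ⟨0, by rintro _ ⟨j, rfl⟩; have := he j; positivity⟩ i

variable [Nonempty ι]

theorem exists_lt_bridgeDist_add (p : A) (q : B) {δ : ℝ} (hδ : 0 < δ) :
    ∃ i, dist p (Φ i) + e i + dist (Ψ i) q < bridgeDist Φ Ψ e p q + δ :=
  exists_lt_of_ciInf_lt (lt_add_of_pos_right _ hδ)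

theorem bridgeDist_le_dist_add_bridgeDist (he : ∀ i, 0 ≤ e i) (p p' : A) (q : B) :
    bridgeDist Φ Ψ e p q ≤ dist p p' + bridgeDist Φ Ψ e p' q := by
  refine le_of_forall_pos_le_add fun δ hδ => ?_
  obtain ⟨i, hi⟩ := exists_lt_bridgeDist_add (Φ := Φ) (Ψ := Ψ) (e := e) p' q hδ
  have hpq := bridgeDist_le (Φ := Φ) (Ψ := Ψ) he p q i
  have hp := dist_triangle p p' (Φ i)
  linarith

theorem dist_le_bridgeDist_add_bridgeDist
    (hdist : ∀ i j, |dist (Φ i) (Φ j) - dist (Ψ i) (Ψ j)| ≤ e i + e j) (p p' : A) (q : B) :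
    dist p p' ≤ bridgeDist Φ Ψ e p q + bridgeDist Φ Ψ e p' q := by
  refine le_of_forall_pos_le_add fun δ hδ => ?_
  obtain ⟨i, hi⟩ := exists_lt_bridgeDist_add (Φ := Φ) (Ψ := Ψ) (e := e) p q (half_pos hδ)
  obtain ⟨j, hj⟩ := exists_lt_bridgeDist_add (Φ := Φ) (Ψ := Ψ) (e := e) p' q (half_pos hδ)
  have hij := (abs_le.1 (hdist i j)).2
  have hA := dist_triangle4 p (Φ i) (Φ j) p'
  have hB := dist_triangle_right (Ψ i) (Ψ j) q
  rw [dist_comm (Φ j) p'] at hA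
  linarith

/-- The disjoint union of `A` and `B`, as a type without a global metric. -/
def BridgeSpace (A : Type u) (B : Type v) : Type (max u v) := A ⊕ B

/-- The pseudometric on the disjoint union for which `bridgeDist` is the distance of points in
different summands. -/
noncomputable abbrev bridgePseudoMetric (Φ : ι → A) (Ψ : ι → B) (e : ι → ℝ) (he : ∀ i, 0 ≤ e i)
    (hdist : ∀ i j, |dist (Φ i) (Φ j) - dist (Ψ i) (Ψ j)| ≤ e i + e j) :
    PseudoMetricSpace (BridgeSpace A B) where
  dist (z w : A ⊕ B) := match z, w with
    | .inl p, .inl p' => dist p p'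
    | .inr q, .inr q' => dist q q'
    | .inl p, .inr q => bridgeDist Φ Ψ e p q
    | .inr q, .inl p => bridgeDist Ψ Φ e q p
  dist_self := by rintro (p | q) <;> exact dist_self _
  dist_comm := by
    rintro (p | q) (p' | q')
    exacts [dist_comm _ _, bridgeDist_comm _ _, bridgeDist_comm _ _, dist_comm _ _]
  dist_triangle := by
    have hdist' (i j) : |dist (Ψ i) (Ψ j) - dist (Φ i) (Φ j)| ≤ e i + e j := by
      rw [abs_sub_comm]; exact hdist i j
    rintro (p | q) (p' | q') (p'' | q'')
    · exact dist_triangle p p' p''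
    · exact bridgeDist_le_dist_add_bridgeDist he p p' q''
    · exact (dist_le_bridgeDist_add_bridgeDist hdist p p'' q').trans_eq
        (congrArg _ (bridgeDist_comm _ _))
    · refine (bridgeDist_comm _ _).trans_le
        ((bridgeDist_le_dist_add_bridgeDist he q'' q' p).trans_eq ?_)
      rw [add_comm, bridgeDist_comm, dist_comm]
    · refine (bridgeDist_comm _ _).trans_le
        ((bridgeDist_le_dist_add_bridgeDist he p'' p' q).trans_eq ?_)
      rw [add_comm, bridgeDist_comm, dist_comm]
    · exact (dist_le_bridgeDist_add_bridgeDist hdist' q q'' p').trans_eq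
        (congrArg _ (bridgeDist_comm _ _))
    · exact bridgeDist_le_dist_add_bridgeDist he q q' p''
    · exact dist_triangle q q' q''

end Bridge

theorem exists_pointedCoupling {A : Type u} {B : Type v} [MetricSpace A] [MetricSpace B]
    {a : A} {b : B} {R : A → B → Prop} {ε : ℝ} (hε : 0 ≤ ε) (base : R a b)
    (distortion : ∀ p q p' q', R p q → R p' q' → |dist p p' - dist q q'| ≤ ε) :
    ∃ c : PointedCoupling a b, ∀ p q, R p q → dist (c.left p) (c.right q) ≤ ε := by
  -- The bridges are the related pairs, with length `ε`, and one of length `0` from `a` to `b`.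
  let ι := Option {z : A × B // R z.1 z.2}
  let Φ : ι → A := fun i => i.elim a fun z => z.1.1
  let Ψ : ι → B := fun i => i.elim b fun z => z.1.2
  let e : ι → ℝ := fun i => i.elim 0 fun _ => ε
  have he : ∀ i, 0 ≤ e i := by
    rintro (_ | _)
    exacts [le_rfl, hε]
  have hdist : ∀ i j, |dist (Φ i) (Φ j) - dist (Ψ i) (Ψ j)| ≤ e i + e j := by
    rintro (_ | ⟨⟨p, q⟩, h⟩) (_ | ⟨⟨p', q'⟩, h'⟩)
    · simp [Φ, Ψ, e]
    · simpa [Φ, Ψ, e] using distortion _ _ _ _ base h'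
    · simpa [Φ, Ψ, e] using distortion _ _ _ _ h base
    · refine (distortion _ _ _ _ h h').trans ?_
      simpa [e] using hε
  let _ := bridgePseudoMetric Φ Ψ e he hdist
  have dist_inl_inr (p : A) (q : B) (i : ι) :
      dist (α := BridgeSpace A B) (Sum.inl p) (Sum.inr q) ≤ dist p (Φ i) + e i + dist (Ψ i) q :=
    bridgeDist_le he p q i
  refine ⟨{ Z := SeparationQuotient (BridgeSpace A B)
            left := fun p => SeparationQuotient.mk (Sum.inl p : A ⊕ B)
            right := fun q => SeparationQuotient.mk (Sum.inr q : A ⊕ B)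
            isometry_left := Isometry.of_dist_eq fun p p' => SeparationQuotient.dist_mk _ _
            isometry_right := Isometry.of_dist_eq fun q q' => SeparationQuotient.dist_mk _ _
            base_eq := ?_ }, fun p q h => ?_⟩
  · refine dist_le_zero.1 ((SeparationQuotient.dist_mk _ _).trans_le
      ((dist_inl_inr a b none).trans ?_))
    simp [Φ, Ψ, e]
  · refine (SeparationQuotient.dist_mk _ _).trans_le
      ((dist_inl_inr p q (some ⟨(p, q), h⟩)).trans ?_)
    simp [Φ, Ψ, e]

/-! ### Correspondences between balls -/

/-- `R` is a correspondence of distortion at most `ε` between parts of two spaces which relates `a`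
to `b`, every point of `B_r(a)` to a point of `B_r(b)`, and conversely. -/
structure IsBallCorrespondence {A : Type*} {B : Type*} [PseudoMetricSpace A] [PseudoMetricSpace B]
    (a : A) (b : B) (r ε : ℝ) (R : A → B → Prop) : Prop where
  base : R a b
  left : ∀ p ∈ Metric.ball a r, ∃ q ∈ Metric.ball b r, R p q
  right : ∀ q ∈ Metric.ball b r, ∃ p ∈ Metric.ball a r, R p q
  distortion : ∀ p q p' q', R p q → R p' q' → |dist p p' - dist q q'| ≤ ε

/-- The pointed balls `B_r(a)` and `B_r(b)` admit a correspondence of distortion at most `ε`; up to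
a factor `2`, this says that their pointed Gromov–Hausdorff distance is at most `ε`. -/
def BallsClose {A : Type*} {B : Type*} [PseudoMetricSpace A] [PseudoMetricSpace B]
    (a : A) (b : B) (r ε : ℝ) : Prop :=
  ∃ R, IsBallCorrespondence a b r ε R

section BallsClose

variable {A : Type*} {B : Type*} {C : Type*} [PseudoMetricSpace A] [PseudoMetricSpace B]
  [PseudoMetricSpace C] {a : A} {b : B} {c : C} {r ε δ : ℝ}

theorem IsBallCorrespondence.symm {R : A → B → Prop} (h : IsBallCorrespondence a b r ε R) :
    IsBallCorrespondence b a r ε fun q p => R p q :=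
  ⟨h.base, h.right, h.left, fun q p q' p' hpq hpq' => by
    rw [abs_sub_comm]; exact h.distortion _ _ _ _ hpq hpq'⟩

theorem BallsClose.symm (h : BallsClose a b r ε) : BallsClose b a r ε :=
  let ⟨_, hR⟩ := h
  ⟨_, hR.symm⟩

theorem BallsClose.trans (h : BallsClose a b r ε) (h' : BallsClose b c r δ) :
    BallsClose a c r (ε + δ) := by
  obtain ⟨R, hR⟩ := h
  obtain ⟨S, hS⟩ := h'
  refine ⟨fun p w => ∃ q, R p q ∧ S q w, ⟨b, hR.base, hS.base⟩, fun p hp => ?_, fun w hw => ?_, ?_⟩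
  · obtain ⟨q, hq, hpq⟩ := hR.left p hp
    obtain ⟨w, hw, hqw⟩ := hS.left q hq
    exact ⟨w, hw, q, hpq, hqw⟩
  · obtain ⟨q, hq, hqw⟩ := hS.right w hw
    obtain ⟨p, hp, hpq⟩ := hR.right q hq
    exact ⟨p, hp, q, hpq, hqw⟩
  · rintro p w p' w' ⟨q, hpq, hqw⟩ ⟨q', hpq', hqw'⟩
    exact (abs_sub_le _ (dist q q') _).trans
      (add_le_add (hR.distortion _ _ _ _ hpq hpq') (hS.distortion _ _ _ _ hqw hqw'))

theorem ballsClose_of_subsingleton [Subsingleton A] [Subsingleton B] (hr : 0 < r) (hε : 0 ≤ ε) :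
    BallsClose a b r ε :=
  ⟨fun _ _ => True, trivial, fun _ _ => ⟨b, Metric.mem_ball_self hr, trivial⟩,
    fun _ _ => ⟨a, Metric.mem_ball_self hr, trivial⟩, fun p q p' q' _ _ => by
      rwa [Subsingleton.elim p p', Subsingleton.elim q q', dist_self, dist_self, sub_self,
        abs_zero]⟩

theorem ballsClose_of_isometry_of_denseRange {f : A → B} (hf : Isometry f) (hd : DenseRange f)
    (hε : 0 < ε) : BallsClose a (f a) r ε := by
  refine ⟨fun p q => dist (f p) q ≤ ε / 2, ?_, fun p hp => ⟨f p, ?_, ?_⟩, fun q hq => ?_, ?_⟩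
  · rw [dist_self]; positivity
  · rwa [Metric.mem_ball, hf.dist_eq]
  · rw [dist_self]; positivity
  · obtain ⟨p, hp⟩ := hd.exists_mem_open (Metric.isOpen_ball.inter Metric.isOpen_ball)
      ⟨q, hq, Metric.mem_ball_self (half_pos hε)⟩
    exact ⟨p, by simpa only [Metric.mem_ball, hf.dist_eq] using hp.1, (Metric.mem_ball.1 hp.2).le⟩
  · intro p q p' q' hpq hpq'
    rw [← hf.dist_eq]
    exact (dist_dist_dist_le _ _ _ _).trans (by linarith)

theorem ballsClose_of_net {f : B → A} {t : Set B} (hb : b ∈ t) (hfb : f b = a)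
    (ht : t ⊆ Metric.ball b r) (hft : MapsTo f t (Metric.ball a r))
    (net : ∀ q ∈ Metric.ball b r, ∃ y ∈ t, dist q y ≤ δ)
    (net_image : ∀ p ∈ Metric.ball a r, ∃ y ∈ t, dist p (f y) ≤ δ)
    (distortion : ∀ y ∈ t, ∀ y' ∈ t, |dist (f y) (f y') - dist y y'| ≤ δ) :
    BallsClose a b r (5 * δ) := by
  have hδ : 0 ≤ δ := (abs_nonneg _).trans (distortion b hb b hb)
  refine ⟨fun p q => ∃ y ∈ t, dist p (f y) ≤ δ ∧ dist q y ≤ δ, ⟨b, hb, ?_, ?_⟩, fun p hp => ?_,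
    fun q hq => ?_, ?_⟩
  · rwa [hfb, dist_self]
  · rwa [dist_self]
  · obtain ⟨y, hy, hpy⟩ := net_image p hp
    exact ⟨y, ht hy, y, hy, hpy, by rwa [dist_self]⟩
  · obtain ⟨y, hy, hqy⟩ := net q hq
    exact ⟨f y, hft hy, y, hy, by rwa [dist_self], hqy⟩
  · rintro p q p' q' ⟨y, hy, hpy, hqy⟩ ⟨y', hy', hpy', hqy'⟩
    have hA := abs_le.1 (dist_dist_dist_le p p' (f y) (f y'))
    have hB := abs_le.1 (dist_dist_dist_le q q' y y')
    have hf := abs_le.1 (distortion y hy y' hy')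
    rw [abs_le]
    constructor <;> linarith

end BallsClose

section PointedGHDist

variable {A : Type u} {B : Type v} [MetricSpace A] [MetricSpace B] {a : A} {b : B} {r ε : ℝ}

theorem BallsClose.pointedGHDist_le (hr : 0 < r) (hε : 0 ≤ ε) (h : BallsClose a b r ε) :
    pointedGHDist (⟨a, Metric.mem_ball_self hr⟩ : Metric.ball a r)
      (⟨b, Metric.mem_ball_self hr⟩ : Metric.ball b r) ≤ ENNReal.ofReal ε := by
  obtain ⟨R, hR⟩ := h
  obtain ⟨c, hc⟩ := exists_pointedCoupling (a := (⟨a, Metric.mem_ball_self hr⟩ : Metric.ball a r))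
    (b := (⟨b, Metric.mem_ball_self hr⟩ : Metric.ball b r)) (R := fun p q => R p q) hε hR.base
    fun p q p' q' => hR.distortion _ _ _ _
  refine (iInf_le _ c).trans (Metric.hausdorffEDist_le_of_mem_edist ?_ ?_)
  · rintro _ ⟨p, rfl⟩
    obtain ⟨q, hq, hpq⟩ := hR.left p p.2
    refine ⟨_, ⟨⟨q, hq⟩, rfl⟩, ?_⟩
    rw [edist_dist]
    exact ENNReal.ofReal_le_ofReal (hc p ⟨q, hq⟩ hpq)
  · rintro _ ⟨q, rfl⟩
    obtain ⟨p, hp, hpq⟩ := hR.right q q.2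
    refine ⟨_, ⟨⟨p, hp⟩, rfl⟩, ?_⟩
    rw [edist_comm, edist_dist]
    exact ENNReal.ofReal_le_ofReal (hc ⟨p, hp⟩ q hpq)

theorem ballsClose_of_pointedGHDist_lt (hr : 0 < r) (hε : 0 < ε)
    (h : pointedGHDist (⟨a, Metric.mem_ball_self hr⟩ : Metric.ball a r)
      (⟨b, Metric.mem_ball_self hr⟩ : Metric.ball b r) < ENNReal.ofReal ε) :
    BallsClose a b r (2 * ε) := by
  obtain ⟨c, hc⟩ := iInf_lt_iff.1 h
  refine ⟨fun p q => ∃ hp hq, dist (c.left ⟨p, hp⟩) (c.right ⟨q, hq⟩) < ε,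
    ⟨Metric.mem_ball_self hr, Metric.mem_ball_self hr, ?_⟩, fun p hp => ?_, fun q hq => ?_, ?_⟩
  · rwa [c.base_eq, dist_self]
  · obtain ⟨_, ⟨q, rfl⟩, hq⟩ := Metric.exists_edist_lt_of_hausdorffEDist_lt
      (mem_range_self (⟨p, hp⟩ : Metric.ball a r)) hc
    rw [edist_dist, ENNReal.ofReal_lt_ofReal_iff hε] at hq
    exact ⟨q, q.2, hp, q.2, hq⟩
  · rw [Metric.hausdorffEDist_comm] at hc
    obtain ⟨_, ⟨p, rfl⟩, hp⟩ := Metric.exists_edist_lt_of_hausdorffEDist_lt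
      (mem_range_self (⟨q, hq⟩ : Metric.ball b r)) hc
    rw [edist_comm, edist_dist, ENNReal.ofReal_lt_ofReal_iff hε] at hp
    exact ⟨p, p.2, p.2, hq, hp⟩
  · rintro p q p' q' ⟨hp, hq, hpq⟩ ⟨hp', hq', hpq'⟩
    have hA : dist (c.left ⟨p, hp⟩) (c.left ⟨p', hp'⟩) = dist p p' := c.isometry_left.dist_eq _ _
    have hB : dist (c.right ⟨q, hq⟩) (c.right ⟨q', hq'⟩) = dist q q' :=
      c.isometry_right.dist_eq _ _
    rw [← hA, ← hB]
    exact (dist_dist_dist_le _ _ _ _).trans (by linarith)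

end PointedGHDist

theorem pointedGHTendsto_iff {ι : Type*} {Z : ι → Type u} [∀ i, MetricSpace (Z i)] {z : ∀ i, Z i}
    {l : Filter ι} {Y : Type v} [MetricSpace Y] {y : Y} :
    PointedGHTendsto Z z l Y y ↔
      ∀ r : ℝ, 0 < r → ∀ ε : ℝ, 0 < ε → ∀ᶠ i in l, BallsClose (z i) y r ε := by
  refine ⟨fun h r hr ε hε => ?_, fun h r hr => ENNReal.tendsto_nhds_zero.2 fun ε hε => ?_⟩
  · have hε' : (0 : ℝ≥0∞) < ENNReal.ofReal (ε / 2) := ENNReal.ofReal_pos.2 (half_pos hε)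
    filter_upwards [(h r hr).eventually_lt_const hε'] with i hi
    have := ballsClose_of_pointedGHDist_lt hr (half_pos hε) hi
    rwa [mul_div_cancel₀ _ two_ne_zero] at this
  · obtain ⟨δ, hδ0, hδ⟩ : ∃ δ : ℝ, 0 < δ ∧ ENNReal.ofReal δ ≤ ε := by
      obtain ⟨δ, hδ0, hδ⟩ := ENNReal.lt_iff_exists_nnreal_btwn.1 hε
      exact ⟨δ, by exact_mod_cast hδ0, by simpa using hδ.le⟩
    filter_upwards [h r hr δ hδ0] with i hi
    exact (hi.pointedGHDist_le hr hδ0.le).trans hδ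

/-! ### Uniqueness of proper limits -/

theorem properSpace_of_totallyBounded_ball {B : Type*} [PseudoMetricSpace B] [CompleteSpace B]
    (b : B) (htb : ∀ r : ℝ, 0 < r → TotallyBounded (Metric.ball b r)) : ProperSpace B := by
  refine ProperSpace.of_seq_closedBall (β := ℕ) (l := atTop) (x := b) (r := fun n => (n : ℝ))
    tendsto_natCast_atTop_atTop (Eventually.of_forall fun n => ?_)
  refine ((htb (n + 1) (by positivity)).subset ?_).isCompact_of_isClosed Metric.isClosed_closedBall
  exact Metric.closedBall_subset_ball (by linarith)

section Transfer

variable {A : Type*} {B : Type*} [PseudoMetricSpace A] [PseudoMetricSpace B] {a : A} {b : B} {r : ℝ}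

theorem totallyBounded_ball_of_ballsClose (hA : TotallyBounded (Metric.ball a r))
    (h : ∀ ε : ℝ, 0 < ε → BallsClose a b r ε) : TotallyBounded (Metric.ball b r) := by
  refine Metric.totallyBounded_iff.2 fun ε hε => ?_
  obtain ⟨R, hR⟩ := h (ε / 2) (half_pos hε)
  obtain ⟨t, ht, ht_fin, hcov⟩ := Metric.finite_approx_of_totallyBounded hA (ε / 2) (half_pos hε)
  have : Nonempty B := ⟨b⟩
  choose! f _ hf using hR.left
  refine ⟨image f t, ht_fin.image f, fun q hq => ?_⟩
  obtain ⟨p, hp, hpq⟩ := hR.right q hq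
  obtain ⟨z, hz, hpz⟩ := mem_iUnion₂.1 (hcov hp)
  refine mem_iUnion₂.2 ⟨f z, mem_image_of_mem f hz, Metric.mem_ball.2 ?_⟩
  have hdist := (abs_le.1 (hR.distortion _ _ _ _ hpq (hf z (ht hz)))).1
  rw [Metric.mem_ball] at hpz
  linarith

theorem properSpace_of_ballsClose [ProperSpace A] [CompleteSpace B]
    (h : ∀ r : ℝ, 0 < r → ∀ ε : ℝ, 0 < ε → BallsClose a b r ε) : ProperSpace B :=
  properSpace_of_totallyBounded_ball b fun r hr => totallyBounded_ball_of_ballsClose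
    ((isCompact_closedBall a r).totallyBounded.subset Metric.ball_subset_closedBall) (h r hr)

end Transfer

/-- The limit of a family of relations along a filter `U`: points are related if they are limits of
related points. -/
def LimitRelation {ι A B : Type*} [TopologicalSpace A] [TopologicalSpace B] (U : Filter ι)
    (R : ι → A → B → Prop) (p : A) (q : B) : Prop :=
  ∃ (p' : ι → A) (q' : ι → B),
    Tendsto p' U (𝓝 p) ∧ Tendsto q' U (𝓝 q) ∧ ∀ᶠ i in U, R i (p' i) (q' i)

section LimitRelation

variable {ι A B : Type*} [PseudoMetricSpace A] [PseudoMetricSpace B] {a : A} {b : B}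
  {R : ι → A → B → Prop} {ρ ε : ι → ℝ}

theorem LimitRelation.symm {U : Filter ι} {p : A} {q : B} (h : LimitRelation U R p q) :
    LimitRelation U (fun i q p => R i p q) q p :=
  let ⟨p', q', hp', hq', h'⟩ := h
  ⟨q', p', hq', hp', h'⟩

theorem LimitRelation.dist_eq_dist {U : Filter ι} [U.NeBot] (hε : Tendsto ε U (𝓝 0))
    (distortion : ∀ i p q p' q', R i p q → R i p' q' → |dist p p' - dist q q'| ≤ ε i)
    {p₁ p₂ : A} {q₁ q₂ : B} (h₁ : LimitRelation U R p₁ q₁) (h₂ : LimitRelation U R p₂ q₂) :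
    dist p₁ p₂ = dist q₁ q₂ := by
  obtain ⟨s₁, t₁, hs₁, ht₁, hR₁⟩ := h₁
  obtain ⟨s₂, t₂, hs₂, ht₂, hR₂⟩ := h₂
  have hlim : Tendsto (fun i => |dist (s₁ i) (s₂ i) - dist (t₁ i) (t₂ i)|) U
      (𝓝 |dist p₁ p₂ - dist q₁ q₂|) := ((hs₁.dist hs₂).sub (ht₁.dist ht₂)).abs
  have hle := le_of_tendsto_of_tendsto hlim hε (by
    filter_upwards [hR₁, hR₂] with i h₁ h₂ using distortion i _ _ _ _ h₁ h₂)
  exact sub_eq_zero.1 (abs_nonpos_iff.1 hle)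

theorem exists_limitRelation [ProperSpace B] {U : Ultrafilter ι} (hρ : Tendsto ρ U atTop)
    (hε : Tendsto ε U (𝓝 0)) (hR : ∀ i, IsBallCorrespondence a b (ρ i) (ε i) (R i)) (p : A) :
    ∃ q, LimitRelation U R p q := by
  have hex : ∀ᶠ i in U, ∃ q ∈ Metric.closedBall b (dist p a + 1), R i p q := by
    filter_upwards [hρ.eventually_gt_atTop (dist p a), hε.eventually_le_const one_pos]
      with i hi hεi
    obtain ⟨q, -, hpq⟩ := (hR i).left p hi
    have hdist := (abs_le.1 ((hR i).distortion _ _ _ _ hpq (hR i).base)).1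
    exact ⟨q, by rw [Metric.mem_closedBall]; linarith, hpq⟩
  have : Nonempty B := ⟨b⟩
  obtain ⟨q', hq'⟩ := hex.choice
  obtain ⟨q, -, hq⟩ := (isCompact_closedBall b (dist p a + 1)).ultrafilter_le_nhds (U.map q')
    (le_principal_iff.2 (hq'.mono fun _ h => h.1))
  exact ⟨q, fun _ => p, q', tendsto_const_nhds, hq, hq'.mono fun _ h => h.2⟩

end LimitRelation

section Uniqueness

variable {A : Type*} {B : Type*} [MetricSpace A] [MetricSpace B] {a : A} {b : B}

theorem exists_isometryEquiv_of_bitotal {L : A → B → Prop} (left : ∀ p, ∃ q, L p q)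
    (right : ∀ q, ∃ p, L p q)
    (dist_eq : ∀ p q p' q', L p q → L p' q' → dist p p' = dist q q') :
    ∃ e : A ≃ᵢ B, ∀ p q, L p q → e p = q := by
  choose f hf using left
  have f_eq {p q} (h : L p q) : f p = q :=
    dist_eq_zero.1 ((dist_eq p (f p) p q (hf p) h).symm.trans (dist_self p))
  have isometry : Isometry f :=
    Isometry.of_dist_eq fun p p' => (dist_eq p _ p' _ (hf p) (hf p')).symm
  have surjective : Function.Surjective f := fun q =>
    let ⟨p, hp⟩ := right q
    ⟨p, f_eq hp⟩
  exact ⟨⟨Equiv.ofBijective f ⟨isometry.injective, surjective⟩, isometry⟩, fun p q => f_eq⟩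

theorem exists_isometryEquiv_of_ballsClose [ProperSpace A] [ProperSpace B]
    (h : ∀ r : ℝ, 0 < r → ∀ ε : ℝ, 0 < ε → BallsClose a b r ε) : ∃ e : A ≃ᵢ B, e a = b := by
  have hpos (n : ℕ) : (0 : ℝ) < n + 1 := by positivity
  choose R hR using fun n : ℕ => h (n + 1) (hpos n) (1 / (n + 1)) (one_div_pos.2 (hpos n))
  let U : Ultrafilter ℕ := hyperfilter ℕ
  have hU : (U : Filter ℕ) ≤ atTop := Nat.hyperfilter_le_atTop
  have hρ : Tendsto (fun n : ℕ => (n : ℝ) + 1) U atTop :=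
    (tendsto_atTop_add_const_right _ 1 tendsto_natCast_atTop_atTop).mono_left hU
  have hε : Tendsto (fun n : ℕ => 1 / ((n : ℝ) + 1)) U (𝓝 0) :=
    tendsto_one_div_add_atTop_nhds_zero_nat.mono_left hU
  obtain ⟨e, he⟩ := exists_isometryEquiv_of_bitotal (L := LimitRelation U R)
    (exists_limitRelation hρ hε hR)
    (fun q => (exists_limitRelation hρ hε (fun n => (hR n).symm) q).imp fun _ hp => hp.symm)
    (fun _ _ _ _ => LimitRelation.dist_eq_dist hε fun n => (hR n).distortion)
  exact ⟨e, he a b ⟨_, _, tendsto_const_nhds, tendsto_const_nhds,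
    Eventually.of_forall fun n => (hR n).base⟩⟩

theorem PointedGHTendsto.exists_isometryEquiv [ProperSpace A] [CompleteSpace B] {ι : Type*}
    {l : Filter ι} [l.NeBot] {Z : ι → Type u} [∀ i, MetricSpace (Z i)] {z : ∀ i, Z i}
    (hA : PointedGHTendsto Z z l A a) (hB : PointedGHTendsto Z z l B b) :
    ∃ e : A ≃ᵢ B, e a = b := by
  rw [pointedGHTendsto_iff] at hA hB
  have hclose (r : ℝ) (hr : 0 < r) (ε : ℝ) (hε : 0 < ε) : BallsClose a b r ε := by
    obtain ⟨i, hiA, hiB⟩ := ((hA r hr _ (half_pos hε)).and (hB r hr _ (half_pos hε))).exists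
    exact add_halves ε ▸ hiA.symm.trans hiB
  have := properSpace_of_ballsClose hclose
  exact exists_isometryEquiv_of_ballsClose hclose

end Uniqueness

/-! ### Extension of geodesics -/

namespace UnitSpeedGeodesic

variable {X : Type u} [MetricSpace X] {x y : X}

/-- Geodesics from `x` are ordered by extension, so that `IsMaximal` becomes `IsMax`. -/
instance : PartialOrder (UnitSpeedGeodesic x) where
  le γ η := η.Extends γ
  le_refl _ := ⟨Subset.rfl, fun _ _ => rfl⟩
  le_trans _ _ _ h h' := ⟨h.1.trans h'.1, fun _ ht => (h'.2 (h.1 ht)).trans (h.2 ht)⟩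
  le_antisymm _ _ h h' := h'.antisymm h

theorem bddAbove_of_isChain {c : Set (UnitSpeedGeodesic x)} (hc : IsChain (· ≤ ·) c)
    (hne : c.Nonempty) : BddAbove c := by
  classical
  let f : ℝ → X := fun t => if h : ∃ γ ∈ c, t ∈ γ.dom then h.choose.toFun t else x
  have f_eq : ∀ γ ∈ c, ∀ t ∈ γ.dom, f t = γ.toFun t := by
    intro γ hγ t ht
    have h : ∃ γ ∈ c, t ∈ γ.dom := ⟨γ, hγ, ht⟩
    simp only [f, dif_pos h]
    rcases hc.total h.choose_spec.1 hγ with hle | hle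
    · exact (hle.2 h.choose_spec.2).symm
    · exact hle.2 ht
  obtain ⟨ξ, hξ⟩ := hne
  refine ⟨⟨{t | ∃ γ ∈ c, t ∈ γ.dom}, f, ⟨?_⟩, ⟨ξ, hξ, ξ.zero_mem⟩, ?_, ?_, ?_, ?_⟩,
    fun γ hγ => ⟨fun t ht => ⟨γ, hγ, ht⟩, fun t ht => f_eq γ hγ t ht⟩⟩
  · rintro s ⟨η, -, hs⟩ t ⟨γ, hγ, ht⟩ r hr
    exact ⟨γ, hγ, γ.mem_of_le ht ((η.nonneg s hs).trans hr.1) hr.2⟩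
  · rintro t ⟨γ, -, ht⟩
    exact γ.nonneg t ht
  · rw [f_eq ξ hξ 0 ξ.zero_mem, ξ.map_zero]
  · rintro s ⟨γ, hγ, hs⟩ t ⟨η, hη, ht⟩
    obtain ⟨ζ, hζ, hsζ, htζ⟩ : ∃ ζ ∈ c, s ∈ ζ.dom ∧ t ∈ ζ.dom := by
      rcases hc.total hγ hη with hle | hle
      · exact ⟨η, hη, hle.1 hs, ht⟩
      · exact ⟨γ, hγ, hs, hle.1 ht⟩
    rw [f_eq ζ hζ s hsζ, f_eq ζ hζ t htζ, ζ.dist_eq s hsζ t htζ]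
  · exact fun t ht => dif_neg ht

theorem exists_isMaximal_extends (γ : UnitSpeedGeodesic x) :
    ∃ η : UnitSpeedGeodesic x, η.IsMaximal ∧ η.Extends γ := by
  obtain ⟨η, hγη, hη⟩ := zorn_le_nonempty_Ici₀ γ
    (fun c _ hc ζ hζ => bddAbove_of_isChain hc ⟨ζ, hζ⟩) γ le_rfl
  exact ⟨η, fun ζ hζ => (hη.eq_of_le hζ).symm, hγη⟩

open Classical in
/-- The unit speed parametrization, on `[0, d(x, y)]`, of a constant speed geodesic from `x` to
`y`. -/
noncomputable def ofIsGeodesic {c : ℝ → X} (hc : IsGeodesic c x y) : UnitSpeedGeodesic x where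
  dom := Icc 0 (dist x y)
  toFun t := if t ∈ Icc 0 (dist x y) then c (t / dist x y) else x
  ordConnected := ordConnected_Icc
  zero_mem := ⟨le_rfl, dist_nonneg⟩
  nonneg t ht := ht.1
  map_zero := by simp [hc.source]
  dist_eq s hs t ht := by
    have div_mem : ∀ t ∈ Icc 0 (dist x y), t / dist x y ∈ Icc (0 : ℝ) 1 := fun t ht =>
      ⟨div_nonneg ht.1 dist_nonneg, div_le_one_of_le₀ ht.2 dist_nonneg⟩
    have div_mul : ∀ t ∈ Icc 0 (dist x y), t / dist x y * dist x y = t := fun t ht =>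
      div_mul_cancel_of_imp fun h => le_antisymm (h ▸ ht.2) ht.1
    rw [if_pos hs, if_pos ht, hc.dist_eq _ (div_mem s hs) _ (div_mem t ht),
      ← abs_of_nonneg (dist_nonneg (x := x) (y := y)), ← abs_mul, sub_mul,
      abs_of_nonneg dist_nonneg, div_mul s hs, div_mul t ht]
  outside t ht := if_neg ht

theorem ofIsGeodesic_dist {c : ℝ → X} (hc : IsGeodesic c x y) :
    (ofIsGeodesic hc).toFun (dist x y) = y := by
  refine (if_pos ⟨dist_nonneg, le_rfl⟩).trans ?_
  rcases eq_or_ne x y with rfl | hxy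
  · rw [dist_self, zero_div, hc.source]
  · rw [div_self (dist_pos.2 hxy).ne', hc.target]

end UnitSpeedGeodesic

theorem exists_maximalGeodesic_through {X : Type u} [MetricSpace X] [IsBusemannConcave X]
    (x y : X) : ∃ γ : MaximalGeodesic x, dist x y ∈ γ.1.dom ∧ γ.1.toFun (dist x y) = y := by
  obtain ⟨c, hc⟩ := IsBusemannConcave.exists_geodesic x y
  obtain ⟨γ, hγ, hext⟩ := (UnitSpeedGeodesic.ofIsGeodesic hc).exists_isMaximal_extends
  have hmem : dist x y ∈ (UnitSpeedGeodesic.ofIsGeodesic hc).dom := ⟨dist_nonneg, le_rfl⟩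
  exact ⟨⟨γ, hγ⟩, hext.1 hmem, (hext.2 hmem).trans (UnitSpeedGeodesic.ofIsGeodesic_dist hc)⟩

/-! ### The exponential map -/

/-- The filter of scales tending to `0`, along which blow-ups are taken. -/
abbrev smallScales : Filter (Ioi (0 : ℝ)) := comap (fun lam : Ioi (0 : ℝ) => (lam : ℝ)) (𝓝 0)

instance : smallScales.NeBot :=
  mem_closure_iff_comap_neBot.1 (by rw [closure_Ioi]; exact self_mem_Ici)

theorem eventually_smallScales_le {c : ℝ} (hc : 0 < c) :
    ∀ᶠ lam : Ioi (0 : ℝ) in smallScales, (lam : ℝ) ≤ c :=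
  tendsto_comap.eventually_le_const hc

namespace PreTangentCone

section Exp

variable {X : Type u} [MetricSpace X] {x : X}

/-- The class of `(γ, s)` in the pre-tangent cone. -/
def mk (γ : MaximalGeodesic x) (s : ℝ≥0) : PreTangentCone x := Quotient.mk (tipSetoid x) (γ, s)

theorem exists_eq_mk (p : PreTangentCone x) : ∃ γ s, p = mk γ s :=
  let ⟨⟨γ, s⟩, h⟩ := Quotient.exists_rep p
  ⟨γ, s, h.symm⟩

/-- The points `(γ, s)` of the pre-tangent cone for which `γ (lam * s)` is defined. -/
def expDomain (lam : Ioi (0 : ℝ)) : Set (PreTangentCone x) :=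
  {p | Quotient.lift (fun z : MaximalGeodesic x × ℝ≥0 => (lam : ℝ) * z.2 ∈ z.1.1.dom) (by
    rintro z w (rfl | ⟨hz, hw⟩)
    · rfl
    · simp [hz, hw, UnitSpeedGeodesic.zero_mem]) p}

/-- The exponential map at scale `lam`, which sends `(γ, s)` to `γ (lam * s)`. Outside `expDomain`
it has the junk value `x`. -/
def exp (lam : Ioi (0 : ℝ)) : PreTangentCone x → Blowup X lam :=
  Quotient.lift (fun z => ⟨z.1.1.toFun (lam * z.2)⟩) (by
    rintro z w (rfl | ⟨hz, hw⟩)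
    · rfl
    · simp [hz, hw, UnitSpeedGeodesic.map_zero])

variable {lam : Ioi (0 : ℝ)} {γ : MaximalGeodesic x} {s : ℝ≥0}

theorem mk_mem_expDomain : mk γ s ∈ expDomain lam ↔ (lam : ℝ) * s ∈ γ.1.dom := Iff.rfl

theorem exp_tip : exp lam (tip x) = ⟨x⟩ :=
  Blowup.ext (by simp [exp, tip, UnitSpeedGeodesic.map_zero])

theorem dist_exp_mk (h : mk γ s ∈ expDomain lam) : dist (exp lam (mk γ s)) ⟨x⟩ = s := by
  change dist (γ.1.toFun (lam * s)) x / lam = s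
  rw [dist_comm, γ.1.dist_base h, mul_div_cancel_left₀ _ (ne_of_gt lam.2)]

variable [IsBusemannConcave X]

theorem exists_exp_eq (y : Blowup X lam) :
    ∃ p : PreTangentCone x, p ∈ expDomain lam ∧ exp lam p = y := by
  obtain ⟨γ, hmem, hγ⟩ := exists_maximalGeodesic_through x y.val
  have hmul : lam * (dist x y.val / lam) = dist x y.val := mul_div_cancel₀ _ (ne_of_gt lam.2)
  refine ⟨mk γ ⟨dist x y.val / lam, div_nonneg dist_nonneg (le_of_lt lam.2)⟩, ?_, Blowup.ext ?_⟩
  · exact mk_mem_expDomain.2 (hmul.symm ▸ hmem)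
  · exact (congrArg γ.1.toFun hmul).trans hγ

theorem dist_exp_le (hlam : (lam : ℝ) ≤ 1) {p q : PreTangentCone x} (hp : p ∈ expDomain lam)
    (hq : q ∈ expDomain lam) : dist (exp lam p) (exp lam q) ≤ dist p q := by
  obtain ⟨γ, s, rfl⟩ := exists_eq_mk p
  obtain ⟨η, t, rfl⟩ := exists_eq_mk q
  exact le_csSup (bddAbove_scaledDists (γ, s) (η, t)) ⟨lam, lam.2, hlam, hp, hq, rfl⟩

variable [Nontrivial X]

theorem eventually_mem_expDomain (p : PreTangentCone x) :
    ∀ᶠ lam in smallScales, p ∈ expDomain lam := by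
  obtain ⟨γ, s, rfl⟩ := exists_eq_mk p
  obtain ⟨y, hy⟩ := exists_ne x
  obtain ⟨a, ha, ha0⟩ := γ.2.exists_pos hy
  have hlim : Tendsto (fun lam : Ioi (0 : ℝ) => (lam : ℝ) * s) smallScales (𝓝 (0 * s)) :=
    tendsto_comap.mul_const (s : ℝ)
  rw [zero_mul] at hlim
  filter_upwards [hlim.eventually_le_const ha0] with lam hlam
  exact γ.1.mem_of_le ha (mul_nonneg (le_of_lt lam.2) s.2) hlam

theorem tendsto_dist_exp (p q : PreTangentCone x) :
    Tendsto (fun lam => dist (exp lam p) (exp lam q)) smallScales (𝓝 (dist p q)) := by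
  have hdom := (eventually_mem_expDomain p).and
    ((eventually_mem_expDomain q).and (eventually_smallScales_le one_pos))
  refine tendsto_order.2 ⟨fun c hc => ?_, fun c hc => ?_⟩
  · obtain ⟨γ, s, rfl⟩ := exists_eq_mk p
    obtain ⟨η, t, rfl⟩ := exists_eq_mk q
    have hne : (scaledDists (γ, s) (η, t)).Nonempty :=
      let ⟨lam, hγ, hη, hlam⟩ := hdom.exists
      ⟨_, lam, lam.2, hlam, hγ, hη, rfl⟩
    obtain ⟨_, ⟨r, hr, -, hγ, hη, rfl⟩, hlt⟩ := exists_lt_of_lt_csSup hne hc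
    -- Concavity: the distance at a scale below `r` is at least the one at scale `r`.
    filter_upwards [eventually_smallScales_le hr] with lam hlam
    have hanti := scaledDist_antitone γ.1 η.1 hr hγ hη (div_pos lam.2 hr) ((div_le_one hr).2 hlam)
    rw [div_mul_cancel₀ _ hr.ne'] at hanti
    exact hlt.trans_le hanti
  · filter_upwards [hdom] with lam ⟨hp, hq, hlam⟩ using (dist_exp_le hlam hp hq).trans_lt hc

theorem dist_mk_tip (γ : MaximalGeodesic x) (s : ℝ≥0) : dist (mk γ s) (tip x) = s := by
  refine tendsto_nhds_unique_of_eventuallyEq (tendsto_dist_exp _ _) tendsto_const_nhds ?_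
  filter_upwards [eventually_mem_expDomain (mk γ s)] with lam hlam
  rw [exp_tip, dist_exp_mk hlam]

theorem dist_exp_base {p : PreTangentCone x} (hp : p ∈ expDomain lam) :
    dist (exp lam p) ⟨x⟩ = dist p (tip x) := by
  obtain ⟨γ, s, rfl⟩ := exists_eq_mk p
  rw [dist_exp_mk hp, dist_mk_tip]

end Exp

end PreTangentCone

/-! ### Precompactness of the blow-ups -/

/-- The blow-ups at `x` are uniformly totally bounded: for all small scales `lam`, the ball of
radius `r` of the blow-up is covered by a number of `ε`-balls that does not depend on `lam`. -/
def HasUniformlyTotallyBoundedBlowups {X : Type u} [MetricSpace X] (x : X) : Prop :=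
  ∀ (r : ℝ) (ε : ℝ≥0), 0 < r → 0 < ε → ∃ M : ℕ, ∀ᶠ lam in smallScales,
    Metric.externalCoveringNumber ε (Metric.ball (⟨x⟩ : Blowup X lam) r) ≤ M

namespace IsLocallyDoubling

variable {X : Type u} [MetricSpace X]

theorem exists_cover (hX : IsLocallyDoubling X) (x : X) :
    ∃ R, 0 < R ∧ ∀ k : ℕ, ∃ M : ℕ, ∀ r, 0 < r → r ≤ R →
      ∃ s : Finset X, s.card ≤ M ∧ Metric.ball x r ⊆ ⋃ z ∈ s, Metric.ball z (r / 2 ^ k) := by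
  classical
  obtain ⟨R, hR, N, hN⟩ := hX x
  refine ⟨R / 2, half_pos hR, fun k => ⟨N ^ k, fun r hr hrR => ?_⟩⟩
  induction k with
  | zero => exact ⟨{x}, by simp, by simp⟩
  | succ k ih =>
    obtain ⟨s, hs, hcov⟩ := ih
    have hle : r / 2 ^ k ≤ r := div_le_self hr.le (one_le_pow₀ one_le_two)
    have hdoubling (z : X) (hz : z ∈ Metric.ball x R) :=
      hN z hz (r / 2 ^ k) (by positivity) (by linarith)
    choose! t ht htcov using hdoubling
    refine ⟨(s.filter (· ∈ Metric.ball x R)).biUnion t, ?_, fun w hw => ?_⟩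
    · rw [pow_succ]
      exact (Finset.card_biUnion_le_card_mul _ _ _ fun z hz =>
        ht z (Finset.mem_filter.1 hz).2).trans
          (Nat.mul_le_mul_right N ((Finset.card_filter_le _ _).trans hs))
    · obtain ⟨z, hz, hwz⟩ := mem_iUnion₂.1 (hcov hw)
      have hzR : z ∈ Metric.ball x R := by
        rw [Metric.mem_ball] at hw hwz ⊢
        linarith [dist_triangle_left z x w]
      obtain ⟨v, hv, hwv⟩ := mem_iUnion₂.1 (htcov z hzR hwz)
      refine mem_iUnion₂.2 ⟨v, Finset.mem_biUnion.2 ⟨z, Finset.mem_filter.2 ⟨hz, hzR⟩, hv⟩, ?_⟩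
      rwa [pow_succ, ← div_div]

theorem hasUniformlyTotallyBoundedBlowups (hX : IsLocallyDoubling X) (x : X) :
    HasUniformlyTotallyBoundedBlowups x := by
  intro r ε hr hε
  obtain ⟨R, hR, hcov⟩ := hX.exists_cover x
  obtain ⟨k, hk⟩ : ∃ k : ℕ, r / ε < 2 ^ k := pow_unbounded_of_one_lt _ one_lt_two
  obtain ⟨M, hM⟩ := hcov k
  refine ⟨M, ?_⟩
  filter_upwards [eventually_smallScales_le (div_pos hR hr)] with lam hlam
  have hlam0 : (0 : ℝ) < lam := lam.2
  obtain ⟨s, hs, hcov⟩ := hM (lam * r) (mul_pos hlam0 hr) ((le_div_iff₀ hr).1 hlam)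
  have hcover : Metric.IsCover ε (Metric.ball (⟨x⟩ : Blowup X lam) r)
      (Blowup.mk '' (s : Set X)) := by
    intro p hp
    have hpx : p.val ∈ Metric.ball x (lam * r) := (div_lt_iff₀' hlam0).1 hp
    obtain ⟨z, hz, hpz⟩ := mem_iUnion₂.1 (hcov hpx)
    refine ⟨⟨z⟩, mem_image_of_mem _ hz, ?_⟩
    have hdist : dist p.val z / lam ≤ ε := by
      rw [div_le_iff₀' hlam0]
      refine hpz.le.trans ?_
      rw [mul_div_assoc]
      have hε' : (0 : ℝ) < ε := hε
      exact mul_le_mul_of_nonneg_left ((div_lt_comm₀ hε' (by positivity)).1 hk).le hlam0.le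
    exact edist_le_coe.2 hdist
  refine hcover.externalCoveringNumber_le_encard.trans ((encard_image_le _ _).trans ?_)
  rw [encard_coe_eq_coe_finsetCard]
  exact_mod_cast hs

end IsLocallyDoubling

theorem coe_lt_edist {A : Type*} [PseudoMetricSpace A] {ε : ℝ≥0} {p q : A} :
    (ε : ℝ≥0∞) < edist p q ↔ (ε : ℝ) < dist p q := by
  rw [edist_nndist, ENNReal.coe_lt_coe, ← NNReal.coe_lt_coe, coe_nndist]

theorem packingNumber_le_of_tendsto_dist {ι : Type*} {l : Filter ι} [l.NeBot] {A : ι → Type*}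
    [∀ i, PseudoMetricSpace (A i)] {B : Type*} [PseudoMetricSpace B] {f : ∀ i, B → A i}
    {s : Set B} {t : ∀ i, Set (A i)} {ε : ℝ≥0} {M : ℕ}
    (hdist : ∀ p ∈ s, ∀ q ∈ s, Tendsto (fun i => dist (f i p) (f i q)) l (𝓝 (dist p q)))
    (hmem : ∀ p ∈ s, ∀ᶠ i in l, f i p ∈ t i)
    (hM : ∀ᶠ i in l, Metric.packingNumber ε (t i) ≤ M) : Metric.packingNumber ε s ≤ M := by
  have hfin (C : Set B) (hCs : C ⊆ s) (hC : Metric.IsSeparated ε C) (hCfin : C.Finite) :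
      C.encard ≤ M := by
    have hsep : ∀ᶠ i in l, ∀ p ∈ C, ∀ q ∈ C, p ≠ q → (ε : ℝ) < dist (f i p) (f i q) := by
      refine hCfin.eventually_all.2 fun p hp => hCfin.eventually_all.2 fun q hq => ?_
      by_cases hpq : p = q
      · exact .of_forall fun _ h => absurd hpq h
      · have hlt : (ε : ℝ) < dist p q := coe_lt_edist.1 (hC hp hq hpq)
        filter_upwards [(hdist p (hCs hp) q (hCs hq)).eventually_const_lt hlt] with i hi _ using hi
    have hmemC : ∀ᶠ i in l, ∀ p ∈ C, f i p ∈ t i :=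
      hCfin.eventually_all.2 fun p hp => hmem p (hCs hp)
    obtain ⟨i, hsep, hmemC, hM⟩ := (hsep.and (hmemC.and hM)).exists
    have hinj : InjOn (f i) C := fun p hp q hq hpq => by
      by_contra hne
      have hlt := hsep p hp q hq hne
      rw [hpq, dist_self] at hlt
      exact hlt.not_ge ε.2
    have hsep_image : Metric.IsSeparated ε (f i '' C) := by
      rintro _ ⟨p, hp, rfl⟩ _ ⟨q, hq, rfl⟩ hne
      exact coe_lt_edist.2 (hsep p hp q hq fun h => hne (congrArg _ h))
    rw [← hinj.encard_image]
    exact (hsep_image.encard_le_packingNumber (image_subset_iff.2 hmemC)).trans hM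
  refine iSup₂_le fun C hCs => iSup_le fun hC => ENat.forall_natCast_le_iff_le.1 fun n hn => ?_
  obtain ⟨D, hDC, hD⟩ := exists_subset_encard_eq hn
  rw [← hD]
  exact hfin D (hDC.trans hCs) (hC.subset hDC) (finite_of_encard_eq_coe hD)

section TangentCone

variable {X : Type u} [MetricSpace X] [IsBusemannConcave X] {x : X}

theorem HasUniformlyTotallyBoundedBlowups.totallyBounded_ball_preTangentCone [Nontrivial X]
    (hx : HasUniformlyTotallyBoundedBlowups x) {r : ℝ} (hr : 0 < r) :
    TotallyBounded (Metric.ball (PreTangentCone.tip x) r) := by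
  rw [Metric.totallyBounded_iff]
  intro δ hδ
  lift δ to ℝ≥0 using hδ.le
  have hε : 0 < δ / 4 := div_pos hδ four_pos
  obtain ⟨M, hM⟩ := hx r (δ / 4) hr hε
  have hpacking :
      Metric.packingNumber (2 * (δ / 4)) (Metric.ball (PreTangentCone.tip x) r) ≤ M := by
    refine packingNumber_le_of_tendsto_dist (fun p _ q _ => PreTangentCone.tendsto_dist_exp p q)
      (fun p hp => ?_) (hM.mono fun lam h =>
        (Metric.packingNumber_two_mul_le_externalCoveringNumber _ _).trans h)
    filter_upwards [PreTangentCone.eventually_mem_expDomain p] with lam hlam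
    rwa [Metric.mem_ball, PreTangentCone.dist_exp_base hlam]
  obtain ⟨C, -, hCfin, hC, -⟩ := Metric.exists_set_encard_eq_coveringNumber
    ((Metric.coveringNumber_le_packingNumber _ _).trans hpacking |>.trans_lt
      (ENat.natCast_lt_top M)).ne
  refine ⟨C, hCfin, fun p hp => ?_⟩
  obtain ⟨y, hy, hpy⟩ := hC hp
  have hlt : ((2 * (δ / 4) : ℝ≥0) : ℝ) < δ := by
    push_cast
    linarith
  exact mem_iUnion₂.2 ⟨y, hy, (edist_le_coe.1 hpy).trans_lt hlt⟩

theorem TangentCone.ballsClose_tip {r ε : ℝ} (hε : 0 < ε) :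
    BallsClose (PreTangentCone.tip x) (TangentCone.tip x) r ε :=
  ballsClose_of_isometry_of_denseRange UniformSpace.Completion.coe_isometry
    UniformSpace.Completion.denseRange_coe hε

end TangentCone

/-! ### The tangent cone as a limit -/

section Limit

variable {X : Type u} [MetricSpace X] [IsBusemannConcave X] {x : X}

theorem eventually_ballsClose_preTangentCone [Nontrivial X] {r ε : ℝ}
    (htb : TotallyBounded (Metric.ball (PreTangentCone.tip x) r)) (hr : 0 < r) (hε : 0 < ε) :
    ∀ᶠ lam in smallScales,
      BallsClose (⟨x⟩ : Blowup X lam) (PreTangentCone.tip x) r ε := by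
  have hδ : 0 < ε / 5 := div_pos hε (by norm_num)
  obtain ⟨t₀, ht₀, hfin₀, hnet₀⟩ := Metric.finite_approx_of_totallyBounded htb _ hδ
  let t := insert (PreTangentCone.tip x) t₀
  have hfin : t.Finite := hfin₀.insert _
  have ht : t ⊆ Metric.ball (PreTangentCone.tip x) r :=
    insert_subset (Metric.mem_ball_self hr) ht₀
  have hnet : ∀ q ∈ Metric.ball (PreTangentCone.tip x) r, ∃ y ∈ t, dist q y ≤ ε / 5 := fun q hq =>
    let ⟨y, hy, hqy⟩ := mem_iUnion₂.1 (hnet₀ hq)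
    ⟨y, mem_insert_of_mem _ hy, le_of_lt hqy⟩
  have hdom : ∀ᶠ lam in smallScales, ∀ p ∈ t, p ∈ PreTangentCone.expDomain lam :=
    hfin.eventually_all.2 fun p _ => PreTangentCone.eventually_mem_expDomain p
  have hdistortion : ∀ᶠ lam in smallScales, ∀ p ∈ t, ∀ q ∈ t,
      |dist (PreTangentCone.exp lam p) (PreTangentCone.exp lam q) - dist p q| ≤ ε / 5 :=
    hfin.eventually_all.2 fun p _ => hfin.eventually_all.2 fun q _ =>
      ((PreTangentCone.tendsto_dist_exp p q).eventually (Metric.closedBall_mem_nhds _ hδ))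
  filter_upwards [hdom, hdistortion, eventually_smallScales_le one_pos] with lam hdom hdist hlam
  rw [← mul_div_cancel₀ ε (by norm_num : (5 : ℝ) ≠ 0)]
  refine ballsClose_of_net (mem_insert _ _) PreTangentCone.exp_tip ht (fun p hp => ?_) hnet
    (fun p hp => ?_) hdist
  · rw [Metric.mem_ball, PreTangentCone.dist_exp_base (hdom p hp)]
    exact ht hp
  · obtain ⟨q, hq, rfl⟩ := PreTangentCone.exists_exp_eq (x := x) p
    rw [Metric.mem_ball, PreTangentCone.dist_exp_base hq] at hp
    obtain ⟨y, hy, hqy⟩ := hnet q hp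
    exact ⟨y, hy, (PreTangentCone.dist_exp_le hlam hq (hdom y hy)).trans hqy⟩

instance [Subsingleton X] : Subsingleton (TangentCone x) := by
  have hdist : ∀ p q : PreTangentCone x, dist p q = 0 := by
    rintro ⟨p⟩ ⟨q⟩
    refine le_antisymm (Real.sSup_le ?_ le_rfl) dist_nonneg
    rintro _ ⟨r, -, -, -, -, rfl⟩
    rw [Subsingleton.elim (p.1.1.toFun _) (q.1.1.toFun _), dist_self, zero_div]
  refine ⟨fun a b => dist_eq_zero.1 ?_⟩
  induction a, b using UniformSpace.Completion.induction_on₂ with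
  | hp => exact isClosed_eq continuous_dist continuous_const
  | ih p q => rw [UniformSpace.Completion.dist_eq, hdist]

theorem HasUniformlyTotallyBoundedBlowups.properSpace_tangentCone
    (hx : HasUniformlyTotallyBoundedBlowups x) : ProperSpace (TangentCone x) := by
  cases subsingleton_or_nontrivial X
  · infer_instance
  · exact properSpace_of_totallyBounded_ball (TangentCone.tip x) fun _ hr =>
      totallyBounded_ball_of_ballsClose (hx.totallyBounded_ball_preTangentCone hr)
        fun _ => TangentCone.ballsClose_tip

theorem HasUniformlyTotallyBoundedBlowups.pointedGHTendsto_tangentCone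
    (hx : HasUniformlyTotallyBoundedBlowups x) :
    PointedGHTendsto (fun lam => Blowup X lam) (fun lam => (⟨x⟩ : Blowup X lam)) smallScales
      (TangentCone x) (TangentCone.tip x) := by
  refine pointedGHTendsto_iff.2 fun r hr ε hε => ?_
  cases subsingleton_or_nontrivial X
  · have (lam : Ioi (0 : ℝ)) : Subsingleton (Blowup X lam) :=
      ⟨fun p q => Blowup.ext (Subsingleton.elim _ _)⟩
    exact .of_forall fun lam => ballsClose_of_subsingleton hr hε.le
  · have hpre := eventually_ballsClose_preTangentCone
      (hx.totallyBounded_ball_preTangentCone hr) hr (half_pos hε)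
    filter_upwards [hpre] with lam hlam
    rw [← add_halves ε]
    exact hlam.trans (TangentCone.ballsClose_tip (half_pos hε))

end Limit

end BusemannTangent

theorem mainTheorem10_general {X : Type u} [MetricSpace X] [BusemannTangent.IsBusemannConcave X]
    (x : X) (hx : BusemannTangent.HasUniformlyTotallyBoundedBlowups x) :
    ProperSpace (BusemannTangent.TangentCone x) ∧
    BusemannTangent.PointedGHTendsto (fun lam : Ioi (0 : ℝ) => BusemannTangent.Blowup X lam)
      (fun lam => (⟨x⟩ : BusemannTangent.Blowup X lam))
      (comap (fun lam : Ioi (0 : ℝ) => (lam : ℝ)) (𝓝 0))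
      (BusemannTangent.TangentCone x) (BusemannTangent.TangentCone.tip x) ∧
    ∀ {ι : Type*} (l : Filter ι) [l.NeBot] (lam : ι → Ioi (0 : ℝ)) (Y : Type v) [MetricSpace Y]
      [CompleteSpace Y] (y : Y), Tendsto (fun i => (lam i : ℝ)) l (𝓝 0) →
      BusemannTangent.PointedGHTendsto (fun i => BusemannTangent.Blowup X (lam i))
        (fun i => (⟨x⟩ : BusemannTangent.Blowup X (lam i))) l Y y →
      ∃ e : BusemannTangent.TangentCone x ≃ᵢ Y, e (BusemannTangent.TangentCone.tip x) = y := by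
  have hproper := hx.properSpace_tangentCone
  have hlim := hx.pointedGHTendsto_tangentCone
  refine ⟨hproper, hlim, fun l _ lam Y _ _ y hlam hY => ?_⟩
  exact BusemannTangent.PointedGHTendsto.exists_isometryEquiv
    (fun r hr => (hlim r hr).comp (tendsto_comap_iff.2 hlam)) hY

theorem mainTheorem10 {X : Type u} [MetricSpace X] [CompleteSpace X]
    [BusemannTangent.IsBusemannConcave X] (hX : BusemannTangent.IsLocallyDoubling X) (x : X) :
    LocallyCompactSpace (BusemannTangent.TangentCone x) ∧
    BusemannTangent.PointedGHTendsto (fun lam : Ioi (0 : ℝ) => BusemannTangent.Blowup X lam)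
      (fun lam => (⟨x⟩ : BusemannTangent.Blowup X lam))
      (comap (fun lam : Ioi (0 : ℝ) => (lam : ℝ)) (𝓝 0))
      (BusemannTangent.TangentCone x) (BusemannTangent.TangentCone.tip x) ∧
    ∀ (Y : Type v) [MetricSpace Y] [CompleteSpace Y] (y : Y) (lam : ℕ → Ioi (0 : ℝ)),
      Tendsto (fun n => (lam n : ℝ)) atTop (𝓝 0) →
      BusemannTangent.PointedGHTendsto (fun n => BusemannTangent.Blowup X (lam n))
        (fun n => (⟨x⟩ : BusemannTangent.Blowup X (lam n))) atTop Y y →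
      ∃ e : BusemannTangent.TangentCone x ≃ᵢ Y, e (BusemannTangent.TangentCone.tip x) = y := by
  obtain ⟨hproper, hlim, hunique⟩ :=
    mainTheorem10_general x (hX.hasUniformlyTotallyBoundedBlowups x)
  exact ⟨inferInstance, hlim, fun Y _ _ y lam hlam hY => hunique atTop lam Y y hlam hY⟩
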